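/- Let $n,m\ge 1$ and let $P(\lambda)=A_m\lambda^m+\cdots+A_1\lambda+A_0$ be an $n\times n$ complex matrix polynomial with $\det A_m\neq 0$ and spectrum $\sigma(P)=\{\lambda\in\mathbb C:\det P(\lambda)=0\}$. Let $\|\cdot\|$ be the spectral matrix norm, let $\varepsilon>0$, and let $w_0,\dots,w_m\ge 0$ be weights with $w_0>0$; put $w(t)=w_mt^m+\cdots+w_1t+w_0$. Let $\mathcal B(P,\varepsilon,\mathrm w)$ be the set of all $Q(\lambda)=\sum_{j=0}^m(A_j+\Delta_j)\lambda^j$ with $\Delta_j\in\mathbb C^{n\times n}$ and $\|\Delta_j\|\le\varepsilon w_j$ for $j=0,\dots,m$, and for such $Q$ put $\sigma(Q)=\{\lambda\in\mathbb C:\det Q(\lambda)=0\}$. A Jordan chain of length $s\ge 1$ of $P$ for $\lambda_0\in\sigma(P)$ is a sequence $x_1,\dots,x_s\in\mathbb C^n$ with $x_1\ne0$ and $\sum_{j=1}^{\xi}\frac1{(j-1)!}P^{(j-1)}(\lambda_0)x_{\xi-j+1}=0$ for $\xi=1,\dots,s$. A Jordan triple $(X,J,Y)$ of $P$ is obtained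 as follows. Take a complete system of maximal Jordan chains of $P$: for each eigenvalue $\lambda_0$ of $P$ the number of chains for $\lambda_0$ is $\dim\ker P(\lambda_0)$, their first vectors are linearly independent, and their lengths add up to the multiplicity of $\lambda_0$ as a zero of $\det P$. Then $X\in\mathbb C^{n\times nm}$ has the vectors of these chains as its columns, chain by chain; $J\in\mathbb C^{nm\times nm}$ is the direct sum of the corresponding upper triangular Jordan blocks; and $Y\in\mathbb C^{nm\times n}$ is determined by $$\begin{bmatrix}X\\XJ\\\vdots\\XJ^{m-1}\end{bmatrix}Y=\begin{bmatrix}0\\\vdots\\0\\A_m^{-1}\end{bmatrix},$$ where the $nm\times nm$ matrix on the left is invertible. Let $Q\in\mathcal B(P,\varepsilon,\mathrm w)$, let $(X,J,Y)$ be a Jordan triple of $P$, let $k(P)=\|X\|\,\|Y\|$, and let $p$ be the maximum dimension of the Jordan blocks of $J$. Then for every $\mu\in\sigma(Q)\setminus\sigma(P)$, $$\min_{\lambda\in\sigma(P)}|\mu-\lambda|\le\max\{\vartheta,\vartheta^{1/p}\},\qquad \vartheta=p\,k(P)\,\varepsilon\,w(|\mu|).$$ -/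

import Mathlib

open scoped Matrix.Norms.L2Operator

noncomputable section

/-- An `n × n` complex matrix polynomial `P(z) = A_m z^m + ... + A_1 z + A_0` of (formal) degree `m`,
given by its coefficients `P j = A_j`, `j = 0, ..., m`. -/
abbrev MatPoly (n m : ℕ) : Type := Fin (m + 1) → Matrix (Fin n) (Fin n) ℂ

namespace MatPoly

variable {n m : ℕ}

/-- The matrix polynomial as a matrix with polynomial entries. -/
def toPolyMatrix (P : MatPoly n m) : Matrix (Fin n) (Fin n) (Polynomial ℂ) :=
  ∑ j : Fin (m + 1), (Polynomial.X ^ (j : ℕ) : Polynomial ℂ) • (P j).map Polynomial.C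

/-- The value `P^{(k)}(z)` of the `k`-th derivative of `P`, as a matrix. -/
def derivEval (P : MatPoly n m) (k : ℕ) (z : ℂ) : Matrix (Fin n) (Fin n) ℂ :=
  P.toPolyMatrix.map fun f => (Polynomial.derivative^[k] f).eval z

/-- The value `P(z) = ∑ j, z ^ j A_j`. -/
def eval (P : MatPoly n m) (z : ℂ) : Matrix (Fin n) (Fin n) ℂ :=
  ∑ j : Fin (m + 1), z ^ (j : ℕ) • P j

/-- The spectrum `σ(P) = {z : det P(z) = 0}`. -/
def spectrum (P : MatPoly n m) : Set ℂ := {z | (P.eval z).det = 0}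

/-- The geometric multiplicity of `z`: the dimension of the null space of `P(z)`. -/
def geomMult (P : MatPoly n m) (z : ℂ) : ℕ :=
  Module.finrank ℂ (LinearMap.ker (P.eval z).mulVecLin)

/-- The algebraic multiplicity of `z`: its multiplicity as a zero of the polynomial `det P`. -/
def algMult (P : MatPoly n m) (z : ℂ) : ℕ := P.toPolyMatrix.det.rootMultiplicity z

/-- `x 0, ..., x (s - 1)` is a Jordan chain of length `s ≥ 1` of `P` corresponding to `z`:
`x 0 ≠ 0` and `∑_{k ≤ ξ} P^{(ξ - k)}(z) x_k / (ξ - k)! = 0` for `ξ = 0, ..., s - 1`. -/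
def IsJordanChain (P : MatPoly n m) (z : ℂ) {s : ℕ} (hs : 0 < s) (x : Fin s → Fin n → ℂ) : Prop :=
  x ⟨0, hs⟩ ≠ 0 ∧
    ∀ ξ : Fin s, ∑ k ∈ Finset.Iic ξ,
      (1 / (Nat.factorial ((ξ : ℕ) - (k : ℕ)) : ℂ)) •
        (P.derivEval ((ξ : ℕ) - (k : ℕ)) z).mulVec (x k) = 0

/-- The `s × s` Jordan block with eigenvalue `z` (ones on the superdiagonal). -/
def jordanBlock (z : ℂ) (s : ℕ) : Matrix (Fin s) (Fin s) ℂ :=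
  Matrix.of fun a b => if a = b then z else if (a : ℕ) + 1 = (b : ℕ) then 1 else 0

/-- A complete system of maximal Jordan chains of `P`. To every eigenvalue there correspond as many
chains as its geometric multiplicity, their leading vectors (eigenvectors) are linearly
independent, and their lengths add up to the algebraic multiplicity (so that no chain can be
prolonged). -/
structure JordanSystem (P : MatPoly n m) where
  /-- the number of chains -/
  r : ℕ
  /-- the eigenvalue of each chain -/
  eig : Fin r → ℂ
  /-- the length of each chain -/
  len : Fin r → ℕ
  len_pos : ∀ i, 0 < len i
  /-- the vectors of the chains -/
  chain : (i : Fin r) → Fin (len i) → Fin n → ℂ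
  isJordanChain : ∀ i, P.IsJordanChain (eig i) (len_pos i) (chain i)
  linearIndependent : ∀ z ∈ P.spectrum,
    LinearIndependent ℂ fun i : {i : Fin r // eig i = z} => chain i.1 ⟨0, len_pos i.1⟩
  card_eq : ∀ z ∈ P.spectrum, (Finset.univ.filter fun i => eig i = z).card = P.geomMult z
  sum_len_eq : ∀ z ∈ P.spectrum, ∑ i ∈ Finset.univ.filter (fun i => eig i = z), len i = P.algMult z

namespace JordanSystem

variable {P : MatPoly n m} (S : JordanSystem P)

/-- The index set of the columns of `X`: position `k` in chain `i`. -/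
abbrev Idx : Type := (i : Fin S.r) × Fin (S.len i)

/-- The matrix `X` whose columns are the vectors of the chains. -/
def X : Matrix (Fin n) S.Idx ℂ := Matrix.of fun a c => S.chain c.1 c.2 a

/-- The Jordan matrix `J = J_1 ⊕ ... ⊕ J_r`. -/
def J : Matrix S.Idx S.Idx ℂ :=
  Matrix.blockDiagonal' fun i => jordanBlock (S.eig i) (S.len i)

/-- The block column with blocks `X, X J, ..., X J ^ (m - 1)`. -/
def col : Matrix (Fin m × Fin n) S.Idx ℂ :=
  Matrix.of fun ja c => (S.X * S.J ^ (ja.1 : ℕ)) ja.2 c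

/-- The largest size `p` of the Jordan blocks of `J`. -/
def maxLen : ℕ := Finset.univ.sup S.len

end JordanSystem

/-- The block column with `m` blocks `0, ..., 0, A_m⁻¹`. -/
def lastBlock (P : MatPoly n m) : Matrix (Fin m × Fin n) (Fin n) ℂ :=
  Matrix.of fun ja b => if (ja.1 : ℕ) + 1 = m then (P (Fin.last m))⁻¹ ja.2 b else 0

/-- A Jordan triple `(X, J, Y)` of `P`. When `A_m` is nonsingular, the block column of
`X, X J, ..., X J ^ (m - 1)` is invertible, and `Y` is its inverse times the block column of
`0, ..., 0, A_m⁻¹`, that is, the solution of the linear system `col_mul_Y`. -/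
structure JordanTriple (P : MatPoly n m) extends JordanSystem P where
  /-- the matrix `Y` -/
  Y : Matrix toJordanSystem.Idx (Fin n) ℂ
  col_mul_Y : toJordanSystem.col * Y = P.lastBlock

/-- The condition number `k(P) = ‖X‖ ‖Y‖` of the eigenproblem (spectral norms), with respect to a
given Jordan triple. -/
def JordanTriple.condNumber {P : MatPoly n m} (T : JordanTriple P) : ℝ := ‖T.X‖ * ‖T.Y‖

/-- The class `B(P, ε, w)` of the `Q = ∑ j, (A_j + Δ_j) z ^ j` with `‖Δ_j‖ ≤ ε w_j` for all `j`
(spectral norm). -/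
def perturbations (P : MatPoly n m) (ε : ℝ) (w : Fin (m + 1) → ℝ) : Set (MatPoly n m) :=
  {Q | ∀ j, ‖Q j - P j‖ ≤ ε * w j}

/-- The weight polynomial `w(t) = w_m t^m + ... + w_1 t + w_0`. -/
def weightEval (w : Fin (m + 1) → ℝ) (t : ℝ) : ℝ := ∑ j : Fin (m + 1), w j * t ^ (j : ℕ)

/-- The quantity `ϑ = p k(P) ε w(|μ|)`. -/
def JordanTriple.theta {P : MatPoly n m} (T : JordanTriple P) (ε : ℝ) (w : Fin (m + 1) → ℝ)
    (μ : ℂ) : ℝ :=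
  (T.maxLen : ℝ) * T.condNumber * ε * weightEval w ‖μ‖

end MatPoly

end

/-!
Write `J = L + N` with `L` diagonal (the eigenvalues) and `N` the nilpotent shift, which commutes
with `L`. Expanding `J ^ j` binomially, the Jordan chain conditions say exactly that
`∑ j, A_j X J ^ j = 0` (`sum_coeff_mul_X_mul_J_pow`). The linear system defining `Y` says that the
moments `X J ^ i Y` vanish for `i < m - 1` and equal `A_m⁻¹` for `i = m - 1`. Dividing `μ ^ j - J ^ j`
by `μ - J` as a geometric sum, these two facts give `P(μ) · X (μ - J)⁻¹ Y = 1`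
(`eval_mul_X_mul_resolvent_mul_Y`).

If `μ` is an eigenvalue of `Q` but not of `P`, then `1 + P(μ)⁻¹ (Q(μ) - P(μ))` is singular, so
`1 ≤ ‖P(μ)⁻¹‖ ‖Q(μ) - P(μ)‖ ≤ k(P) ‖(μ - J)⁻¹‖ ε w(|μ|)`. The resolvent is the Neumann series
`∑ k < p, D ^ (k + 1) N ^ k` with `D = (μ - L)⁻¹`. Since `‖N‖ ≤ 1` and `‖D‖` is at most the inverse
of the distance `δ` from `μ` to `σ(P)`, its norm is at most `∑ k < p, δ ^ (-(k + 1))`, which is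
at most `p / δ` when `δ ≥ 1` and at most `p / δ ^ p` when `δ ≤ 1`.
-/

open scoped Matrix

namespace MatPoly

variable {n m : ℕ}

/-! ### Evaluation, derivatives and perturbations of matrix polynomials -/

lemma toPolyMatrix_apply (P : MatPoly n m) (a b : Fin n) :
    P.toPolyMatrix a b = ∑ j : Fin (m + 1), Polynomial.monomial (j : ℕ) (P j a b) := by
  simp only [toPolyMatrix, Matrix.sum_apply, Matrix.smul_apply, Matrix.map_apply, smul_eq_mul]
  refine Finset.sum_congr rfl fun j _ => ?_
  rw [mul_comm, Polynomial.C_mul_X_pow_eq_monomial]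

/-- The Taylor coefficients `P^{(k)}(z) / k!`, expanded in the coefficients of `P`. Terms with `j < k`
vanish because the binomial coefficient does. -/
lemma inv_factorial_smul_derivEval (P : MatPoly n m) (k : ℕ) (z : ℂ) :
    (1 / (Nat.factorial k : ℂ)) • P.derivEval k z =
      ∑ j : Fin (m + 1), ((Nat.choose j k : ℂ) * z ^ ((j : ℕ) - k)) • P j := by
  ext a b
  have hk : (Nat.factorial k : ℂ) ≠ 0 := by exact_mod_cast Nat.factorial_ne_zero k
  have hd (f : Polynomial ℂ) : (Polynomial.derivative^[k] f).eval z =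
      (Nat.factorial k : ℂ) * (Polynomial.hasseDeriv k f).eval z := by
    rw [← Polynomial.factorial_smul_hasseDeriv, LinearMap.smul_apply, Polynomial.eval_smul,
      nsmul_eq_mul]
  simp only [derivEval, Matrix.smul_apply, Matrix.map_apply, Matrix.sum_apply, smul_eq_mul,
    toPolyMatrix_apply, hd, map_sum, Polynomial.hasseDeriv_monomial, Polynomial.eval_finsetSum,
    Polynomial.eval_monomial]
  rw [one_div, inv_mul_cancel_left₀ hk]
  exact Finset.sum_congr rfl fun j _ => by ring

lemma eval_eq_map (P : MatPoly n m) (z : ℂ) :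
    P.eval z = P.toPolyMatrix.map (Polynomial.evalRingHom z) := by
  ext a b
  simp [eval, toPolyMatrix_apply, Matrix.sum_apply, Polynomial.eval_finsetSum, mul_comm]

lemma eval_det (P : MatPoly n m) (z : ℂ) : P.toPolyMatrix.det.eval z = (P.eval z).det := by
  rw [eval_eq_map, ← Polynomial.coe_evalRingHom, RingHom.map_det]
  rfl

lemma spectrum_finite (P : MatPoly n m) {μ : ℂ} (hμ : μ ∉ P.spectrum) : P.spectrum.Finite := by
  have h0 : P.toPolyMatrix.det ≠ 0 := by
    intro h
    exact hμ (by simp [spectrum, ← eval_det, h])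
  refine (Polynomial.finite_setOfPred_isRoot h0).subset fun z hz => ?_
  change P.toPolyMatrix.det.eval z = 0
  rw [eval_det]
  exact hz

lemma eval_sub_eval (P Q : MatPoly n m) (z : ℂ) :
    Q.eval z - P.eval z = ∑ j : Fin (m + 1), z ^ (j : ℕ) • (Q j - P j) := by
  simp [eval, smul_sub, Finset.sum_sub_distrib]

lemma norm_eval_sub_eval_le {P Q : MatPoly n m} {ε : ℝ} {w : Fin (m + 1) → ℝ}
    (hQ : Q ∈ P.perturbations ε w) (z : ℂ) :
    ‖Q.eval z - P.eval z‖ ≤ ε * weightEval w ‖z‖ := by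
  rw [eval_sub_eval, weightEval, Finset.mul_sum]
  refine norm_sum_le_of_le _ fun j _ => ?_
  rw [norm_smul, norm_pow]
  calc ‖z‖ ^ (j : ℕ) * ‖Q j - P j‖ ≤ ‖z‖ ^ (j : ℕ) * (ε * w j) := by gcongr; exact hQ j
    _ = ε * (w j * ‖z‖ ^ (j : ℕ)) := by ring

namespace JordanSystem

variable {P : MatPoly n m} (S : JordanSystem P)

lemma eig_mem_spectrum (i : Fin S.r) : S.eig i ∈ P.spectrum := by
  obtain ⟨h0, h⟩ := S.isJordanChain i
  have h1 := h ⟨0, S.len_pos i⟩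
  have hI : Finset.Iic (⟨0, S.len_pos i⟩ : Fin (S.len i)) = {⟨0, S.len_pos i⟩} := by
    ext k
    simp [Fin.le_def, Fin.ext_iff]
  rw [hI, Finset.sum_singleton, ← Matrix.smul_mulVec, inv_factorial_smul_derivEval] at h1
  refine Matrix.exists_mulVec_eq_zero_iff.1 ⟨_, h0, ?_⟩
  simpa [eval] using h1

/-! ### The Jordan matrix and its powers -/

/-- The nilpotent part of the Jordan matrix: ones on the superdiagonal of every block. -/
def shift : Matrix S.Idx S.Idx ℂ :=
  Matrix.of fun c d => if c.1 = d.1 ∧ (c.2 : ℕ) + 1 = d.2 then 1 else 0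

lemma idx_ext {c d : S.Idx} (h1 : c.1 = d.1) (h2 : (c.2 : ℕ) = d.2) : c = d := by
  obtain ⟨i, a⟩ := c
  obtain ⟨j, b⟩ := d
  obtain rfl : i = j := h1
  obtain rfl : a = b := Fin.ext h2
  rfl

lemma J_eq : S.J = Matrix.diagonal (fun c : S.Idx => S.eig c.1) + S.shift := by
  ext ⟨i, a⟩ ⟨j, b⟩
  by_cases hij : i = j
  · subst hij
    by_cases hab : a = b
    · subst hab
      simp [J, shift, jordanBlock, Matrix.blockDiagonal'_apply]
    · simp [J, shift, jordanBlock, Matrix.blockDiagonal'_apply, hab]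
  · simp [J, shift, Matrix.blockDiagonal'_apply, hij]

lemma shift_pow_apply (k : ℕ) (c d : S.Idx) :
    (S.shift ^ k) c d = if c.1 = d.1 ∧ (c.2 : ℕ) + k = d.2 then 1 else 0 := by
  induction k generalizing d with
  | zero =>
    rw [pow_zero, Matrix.one_apply]
    refine if_congr ⟨by rintro rfl; simp, fun h => S.idx_ext h.1 (by simpa using h.2)⟩ rfl rfl
  | succ k ih =>
    rw [pow_succ, Matrix.mul_apply]
    simp only [ih]
    simp only [shift, Matrix.of_apply]
    rcases Nat.eq_zero_or_pos (d.2 : ℕ) with hd | hd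
    · simp [hd]
    · let e : S.Idx := ⟨d.1, ⟨(d.2 : ℕ) - 1, by omega⟩⟩
      rw [Finset.sum_eq_single e]
      · have he : (e.2 : ℕ) + 1 = d.2 := Nat.sub_add_cancel hd
        rw [if_pos (c := e.1 = d.1 ∧ _) ⟨rfl, he⟩, mul_one]
        refine if_congr (and_congr Iff.rfl ?_) rfl rfl
        omega
      · intro f _ hf
        rw [if_neg (c := f.1 = d.1 ∧ _), mul_zero]
        rintro ⟨h1, h2⟩
        exact hf (S.idx_ext h1 (by change (f.2 : ℕ) = (d.2 : ℕ) - 1; omega))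
      · simp

lemma shift_pow_maxLen : S.shift ^ S.maxLen = 0 := by
  ext c d
  rw [shift_pow_apply, if_neg, Matrix.zero_apply]
  rintro ⟨-, h⟩
  have h1 : S.len d.1 ≤ S.maxLen := Finset.le_sup (f := S.len) (Finset.mem_univ d.1)
  have := d.2.isLt
  omega

/-- `Nᴴ N` is a diagonal matrix with entries `0` and `1`. -/
lemma norm_shift_le_one : ‖S.shift‖ ≤ 1 := by
  have h : S.shiftᴴ * S.shift =
      Matrix.diagonal fun c : S.Idx => if (c.2 : ℕ) = 0 then (0 : ℂ) else 1 := by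
    ext c d
    rw [Matrix.mul_apply, Matrix.diagonal_apply]
    simp only [Matrix.conjTranspose_apply, shift, Matrix.of_apply]
    rcases Nat.eq_zero_or_pos (c.2 : ℕ) with hc | hc
    · simp [hc]
    · let e : S.Idx := ⟨c.1, ⟨(c.2 : ℕ) - 1, by omega⟩⟩
      have he : (e.2 : ℕ) + 1 = c.2 := Nat.sub_add_cancel hc
      rw [Finset.sum_eq_single e, if_pos ⟨rfl, he⟩, if_neg hc.ne', star_one, one_mul]
      · refine if_congr ⟨fun h => S.idx_ext h.1 (by omega), ?_⟩ rfl rfl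
        rintro rfl
        exact ⟨rfl, he⟩
      · intro f _ hf
        rw [if_neg (c := f.1 = c.1 ∧ _), star_zero, zero_mul]
        rintro ⟨h1, h2⟩
        exact hf (S.idx_ext h1 (by omega))
      · simp
  have h2 : ‖S.shift‖ * ‖S.shift‖ ≤ 1 := by
    rw [← Matrix.l2_opNorm_conjTranspose_mul_self, h, Matrix.l2_opNorm_diagonal]
    refine (pi_norm_le_iff_of_nonneg zero_le_one).2 fun c => ?_
    split_ifs <;> simp
  nlinarith [norm_nonneg S.shift]

/-- A diagonal matrix that is constant on each block commutes with the nilpotent part of `J`. -/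
lemma commute_diagonal_shift (f : Fin S.r → ℂ) :
    Commute (Matrix.diagonal fun c : S.Idx => f c.1) S.shift := by
  ext c d
  rw [Matrix.diagonal_mul, Matrix.mul_diagonal, mul_comm]
  simp only [shift, Matrix.of_apply]
  split_ifs with h
  · rw [h.1]
  · simp

lemma J_pow_apply (j : ℕ) (c d : S.Idx) :
    (S.J ^ j) c d = if c.1 = d.1 ∧ (c.2 : ℕ) ≤ d.2 then
      (Nat.choose j ((d.2 : ℕ) - c.2) : ℂ) * S.eig d.1 ^ (j - ((d.2 : ℕ) - c.2)) else 0 := by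
  rw [J_eq, add_comm, (S.commute_diagonal_shift S.eig).symm.add_pow, Matrix.sum_apply]
  simp only [Matrix.diagonal_pow, ← nsmul_eq_mul', Matrix.smul_apply, Matrix.mul_diagonal,
    shift_pow_apply, Pi.pow_apply]
  by_cases h : c.1 = d.1 ∧ (c.2 : ℕ) ≤ d.2
  · rw [if_pos h, Finset.sum_eq_single ((d.2 : ℕ) - c.2)]
    · rw [if_pos ⟨h.1, by omega⟩, one_mul, nsmul_eq_mul]
    · intro k _ hk
      rw [if_neg (by omega), zero_mul, smul_zero]
    · intro hk
      rw [Nat.choose_eq_zero_of_lt (by have := Finset.mem_range.not.1 hk; omega), zero_smul]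
  · rw [if_neg h]
    refine Finset.sum_eq_zero fun k _ => ?_
    rw [if_neg, zero_mul, smul_zero]
    rintro ⟨h1, h2⟩
    exact h ⟨h1, by omega⟩

lemma X_mul_J_pow_col (j : ℕ) (d : S.Idx) :
    (fun a => (S.X * S.J ^ j) a d) = ∑ k ∈ Finset.Iic d.2,
      ((Nat.choose j ((d.2 : ℕ) - k) : ℂ) * S.eig d.1 ^ (j - ((d.2 : ℕ) - k))) •
        S.chain d.1 k := by
  ext a
  rw [Matrix.mul_apply, Fintype.sum_sigma, Finset.sum_eq_single d.1]
  · rw [Finset.sum_apply, ← Finset.sum_subset (Finset.subset_univ (Finset.Iic d.2))]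
    · refine Finset.sum_congr rfl fun k hk => ?_
      rw [J_pow_apply, if_pos ⟨rfl, Fin.le_def.1 (Finset.mem_Iic.1 hk)⟩]
      simp only [X, Matrix.of_apply, Pi.smul_apply, smul_eq_mul]
      ring
    · intro k _ hk
      rw [J_pow_apply, if_neg, mul_zero]
      rintro ⟨-, h⟩
      exact hk (Finset.mem_Iic.2 h)
  · intro i _ hi
    refine Finset.sum_eq_zero fun k _ => ?_
    rw [J_pow_apply, if_neg (fun h => hi h.1), mul_zero]
  · simp

/-- The Jordan chain conditions in matrix form: `A_m X J ^ m + ... + A_1 X J + A_0 X = 0`. -/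
lemma sum_coeff_mul_X_mul_J_pow : ∑ j : Fin (m + 1), P j * (S.X * S.J ^ (j : ℕ)) = 0 := by
  ext a d
  have h := congrFun ((S.isJordanChain d.1).2 d.2) a
  simp only [← Matrix.smul_mulVec, inv_factorial_smul_derivEval, Matrix.sum_mulVec] at h
  rw [Finset.sum_comm] at h
  rw [Matrix.sum_apply, Matrix.zero_apply]
  refine Eq.trans ?_ h
  rw [Finset.sum_apply]
  refine Finset.sum_congr rfl fun j _ => ?_
  change (P j).mulVec (fun b => (S.X * S.J ^ (j : ℕ)) b d) a = _
  rw [X_mul_J_pow_col, Matrix.mulVec_sum]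
  simp only [Matrix.smul_mulVec, Matrix.mulVec_smul]

/-! ### The resolvent of the Jordan matrix -/

/-- The resolvent `(μ - J)⁻¹`, written as the finite Neumann series of `μ - J = E - N`, where `E` is
diagonal and `N` is nilpotent and commutes with `E`. It is the inverse only when `μ` is not one of
the eigenvalues. -/
noncomputable def resolvent (μ : ℂ) : Matrix S.Idx S.Idx ℂ :=
  ∑ k ∈ Finset.range S.maxLen,
    Matrix.diagonal (fun c : S.Idx => (μ - S.eig c.1)⁻¹) ^ (k + 1) * S.shift ^ k

lemma sub_J_mul_resolvent {μ : ℂ} (hμ : ∀ i, S.eig i ≠ μ) :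
    (μ • (1 : Matrix S.Idx S.Idx ℂ) - S.J) * S.resolvent μ = 1 := by
  set D : Matrix S.Idx S.Idx ℂ := Matrix.diagonal (fun c : S.Idx => (μ - S.eig c.1)⁻¹) with hD
  set E : Matrix S.Idx S.Idx ℂ := Matrix.diagonal (fun c : S.Idx => μ - S.eig c.1) with hE
  have hED : E * D = 1 := by
    rw [hE, hD, Matrix.diagonal_mul_diagonal, ← Matrix.diagonal_one]
    congr 1
    ext c
    exact mul_inv_cancel₀ (sub_ne_zero.2 (hμ c.1).symm)
  have hc : Commute D S.shift := S.commute_diagonal_shift fun i => (μ - S.eig i)⁻¹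
  have hJ : μ • (1 : Matrix S.Idx S.Idx ℂ) - S.J = E - S.shift := by
    rw [J_eq, ← Matrix.diagonal_one, ← Matrix.diagonal_smul, ← sub_sub, Matrix.diagonal_sub]
    simp [hE]
  have hterm (k : ℕ) : (E - S.shift) * (D ^ (k + 1) * S.shift ^ k) =
      D ^ k * S.shift ^ k - D ^ (k + 1) * S.shift ^ (k + 1) := by
    rw [sub_mul, ← mul_assoc, ← mul_assoc, ← (hc.pow_left (k + 1)).eq, pow_succ' D, ← mul_assoc E,
      hED, one_mul, pow_succ' S.shift]
    simp only [mul_assoc]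
  rw [hJ, resolvent, Finset.mul_sum, Finset.sum_congr rfl fun k _ => hterm k,
    Finset.sum_range_sub', shift_pow_maxLen]
  simp

lemma norm_resolvent_le {μ : ℂ} {δ : ℝ} (hδ : 0 < δ) (h : ∀ i, δ ≤ ‖μ - S.eig i‖) :
    ‖S.resolvent μ‖ ≤ ∑ k ∈ Finset.range S.maxLen, δ⁻¹ ^ (k + 1) := by
  have hD : ‖Matrix.diagonal (fun c : S.Idx => (μ - S.eig c.1)⁻¹)‖ ≤ δ⁻¹ := by
    rw [Matrix.l2_opNorm_diagonal]
    refine (pi_norm_le_iff_of_nonneg (by positivity)).2 fun c => ?_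
    rw [norm_inv]
    exact inv_anti₀ hδ (h c.1)
  have hN (k : ℕ) : ‖S.shift ^ k‖ ≤ 1 := by
    induction k with
    | zero =>
      rw [pow_zero, ← Matrix.diagonal_one, Matrix.l2_opNorm_diagonal]
      exact (pi_norm_le_iff_of_nonneg zero_le_one).2 fun c => by simp
    | succ k ih =>
      rw [pow_succ]
      exact (norm_mul_le _ _).trans (mul_le_one₀ ih (norm_nonneg _) S.norm_shift_le_one)
  refine norm_sum_le_of_le _ fun k _ => ?_
  calc _ ≤ _ := norm_mul_le _ _
    _ ≤ δ⁻¹ ^ (k + 1) * 1 := by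
      gcongr
      · exact (norm_pow_le' _ k.succ_pos).trans (pow_le_pow_left₀ (norm_nonneg _) hD _)
      · exact hN k
    _ = _ := mul_one _

end JordanSystem

namespace JordanTriple

variable {P : MatPoly n m} (T : JordanTriple P)

/-! ### The resolvent representation of the inverse -/

/-- The defining linear system of `Y`, read block by block. -/
lemma X_mul_J_pow_mul_Y {i : ℕ} (hi : i < m) :
    T.X * T.J ^ i * T.Y = if i + 1 = m then (P (Fin.last m))⁻¹ else 0 := by
  ext a b
  have h := congrFun (congrFun T.col_mul_Y (⟨i, hi⟩, a)) b
  refine Eq.trans ?_ (h.trans ?_)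
  · rfl
  · simp only [lastBlock, Matrix.of_apply]
    split_ifs <;> rfl

/-- The resolvent representation `P(μ)⁻¹ = X (μ - J)⁻¹ Y`. -/
lemma eval_mul_X_mul_resolvent_mul_Y (hm : 1 ≤ m) (hP : (P (Fin.last m)).det ≠ 0) {μ : ℂ}
    (hμ : ∀ i, T.eig i ≠ μ) :
    P.eval μ * (T.X * T.resolvent μ * T.Y) = 1 := by
  set R := T.resolvent μ with hR
  have hres := T.sub_J_mul_resolvent hμ
  rw [← hR] at hres
  -- `μ ^ j - J ^ j` divided by `μ - J` is a geometric sum.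
  have hgeom (j : ℕ) : μ ^ j • R = T.J ^ j * R +
      ∑ i ∈ Finset.range j, μ ^ (j - 1 - i) • T.J ^ i := by
    have hc : Commute T.J (μ • (1 : Matrix T.Idx T.Idx ℂ)) :=
      (Commute.one_right T.J).smul_right μ
    have h := hc.geom_sum₂_mul j
    have h' : (∑ i ∈ Finset.range j, μ ^ (j - 1 - i) • T.J ^ i) * (T.J - μ • 1) =
        T.J ^ j - μ ^ j • 1 := by
      simpa [smul_pow] using h
    have h2 : (T.J - μ • (1 : Matrix T.Idx T.Idx ℂ)) * R = -1 := by
      rw [← neg_sub, neg_mul, hres]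
    have h3 := congrArg (· * R) h'
    simp only [mul_assoc, h2, sub_mul, smul_mul_assoc, one_mul, mul_neg, mul_one] at h3
    rw [← sub_eq_iff_eq_add', ← neg_sub, ← h3, neg_neg]
  -- All moments `X J ^ i Y` with `i < m` vanish except the last one.
  have hterm (j : Fin (m + 1)) :
      (∑ i ∈ Finset.range (j : ℕ), μ ^ ((j : ℕ) - 1 - i) • (T.X * T.J ^ i * T.Y)) =
        if j = Fin.last m then (P (Fin.last m))⁻¹ else 0 := by
    have hj : (j : ℕ) ≤ m := Nat.lt_succ_iff.1 j.isLt
    rw [Finset.sum_congr rfl fun i hi => by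
      rw [T.X_mul_J_pow_mul_Y ((Finset.mem_range.1 hi).trans_le hj)]]
    split_ifs with h
    · subst h
      rw [Finset.sum_eq_single (m - 1)]
      · rw [if_pos (by omega)]
        simp
      · intro i _ hi
        rw [if_neg (by omega), smul_zero]
      · intro h
        exact absurd (Finset.mem_range.2 (by simp; omega)) h
    · refine Finset.sum_eq_zero fun i hi => ?_
      have := Finset.mem_range.1 hi
      have : (j : ℕ) ≠ m := fun h' => h (Fin.ext h')
      rw [if_neg (by omega), smul_zero]
  have hsum (j : Fin (m + 1)) : (μ ^ (j : ℕ) • P j) * (T.X * R * T.Y) =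
      P j * (T.X * T.J ^ (j : ℕ)) * (R * T.Y) +
        if j = Fin.last m then P (Fin.last m) * (P (Fin.last m))⁻¹ else 0 := by
    have h1 : (μ ^ (j : ℕ) • P j) * (T.X * R * T.Y) =
        P j * (T.X * (μ ^ (j : ℕ) • R) * T.Y) := by
      simp only [Matrix.smul_mul, Matrix.mul_smul]
    have h2 : T.X * (∑ i ∈ Finset.range (j : ℕ), μ ^ ((j : ℕ) - 1 - i) • T.J ^ i) * T.Y =
        if j = Fin.last m then (P (Fin.last m))⁻¹ else 0 := by
      rw [← hterm j, Matrix.mul_sum, Matrix.sum_mul]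
      simp only [Matrix.smul_mul, Matrix.mul_smul]
    rw [h1, hgeom, Matrix.mul_add, Matrix.add_mul, h2, Matrix.mul_add]
    congr 1
    · simp only [Matrix.mul_assoc]
    · split_ifs with h
      · rw [h]
      · rw [Matrix.mul_zero]
  rw [eval, Matrix.sum_mul, Finset.sum_congr rfl fun j _ => hsum j, Finset.sum_add_distrib,
    ← Matrix.sum_mul, T.sum_coeff_mul_X_mul_J_pow, Matrix.zero_mul, zero_add,
    Finset.sum_ite_eq' Finset.univ, if_pos (Finset.mem_univ _),
    Matrix.mul_nonsing_inv _ (isUnit_iff_ne_zero.2 hP)]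

/-- If `μ` is an eigenvalue of a perturbation of `P` but not of `P` itself, then
`‖P(μ)⁻¹‖ ‖Q(μ) - P(μ)‖` is at least one; here `P(μ)⁻¹` is estimated through the Jordan triple. -/
lemma one_le_condNumber_mul (hm : 1 ≤ m) (hP : (P (Fin.last m)).det ≠ 0) {ε : ℝ}
    {w : Fin (m + 1) → ℝ} {Q : MatPoly n m} (hQ : Q ∈ P.perturbations ε w) {μ : ℂ}
    (hμ : μ ∈ Q.spectrum) {δ : ℝ} (hδ : 0 < δ) (h : ∀ i, δ ≤ ‖μ - T.eig i‖) :
    1 ≤ T.condNumber * (ε * weightEval w ‖μ‖) *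
      ∑ k ∈ Finset.range T.maxLen, δ⁻¹ ^ (k + 1) := by
  have hne (i) : T.eig i ≠ μ := by
    rintro rfl
    simpa using hδ.trans_le (h i)
  set G := T.X * T.resolvent μ * T.Y with hG
  have hPG : P.eval μ * G = 1 := T.eval_mul_X_mul_resolvent_mul_Y hm hP hne
  have hnorm : ‖G‖ ≤ T.condNumber * ∑ k ∈ Finset.range T.maxLen, δ⁻¹ ^ (k + 1) := by
    calc ‖G‖ ≤ ‖T.X‖ * ‖T.resolvent μ‖ * ‖T.Y‖ :=
          (Matrix.l2_opNorm_mul _ _).trans (by gcongr; exact Matrix.l2_opNorm_mul _ _)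
      _ ≤ ‖T.X‖ * (∑ k ∈ Finset.range T.maxLen, δ⁻¹ ^ (k + 1)) * ‖T.Y‖ := by
          gcongr
          exact T.norm_resolvent_le hδ h
      _ = _ := by rw [condNumber]; ring
  -- Otherwise `1 + G (Q(μ) - P(μ))` would be invertible, and with it `Q(μ)`.
  have hone : 1 ≤ ‖G * (Q.eval μ - P.eval μ)‖ := by
    by_contra! hlt
    have : CompleteSpace (Matrix (Fin n) (Fin n) ℂ) := FiniteDimensional.complete ℂ _
    have hu : IsUnit (1 - -(G * (Q.eval μ - P.eval μ))) :=
      isUnit_one_sub_of_norm_lt_one (by rwa [norm_neg])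
    have hQe : Q.eval μ = P.eval μ * (1 - -(G * (Q.eval μ - P.eval μ))) := by
      rw [sub_neg_eq_add, mul_add, ← mul_assoc, hPG]
      simp
    have hQu : IsUnit (Q.eval μ) := by
      rw [hQe]
      exact (IsUnit.of_mul_eq_one _ hPG).mul hu
    exact ((Matrix.isUnit_iff_isUnit_det _).1 hQu).ne_zero hμ
  calc 1 ≤ ‖G‖ * ‖Q.eval μ - P.eval μ‖ := hone.trans (norm_mul_le _ _)
    _ ≤ (T.condNumber * ∑ k ∈ Finset.range T.maxLen, δ⁻¹ ^ (k + 1)) *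
        (ε * weightEval w ‖μ‖) :=
      mul_le_mul hnorm (norm_eval_sub_eval_le hQ μ) (norm_nonneg _)
        ((norm_nonneg _).trans hnorm)
    _ = _ := by ring

end JordanTriple

end MatPoly

/-! ### The distance bound -/

/-- The scalar inequality behind the bound: the geometric sum is at most `p / δ` when `δ ≥ 1` and at
most `p / δ ^ p` when `δ ≤ 1`. -/
lemma le_max_rpow_of_one_le_mul_sum {p : ℕ} {c δ : ℝ} (hc : 0 ≤ c) (hδ : 0 < δ)
    (h : 1 ≤ c * ∑ k ∈ Finset.range p, δ⁻¹ ^ (k + 1)) :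
    δ ≤ max (p * c) ((p * c) ^ (1 / (p : ℝ))) := by
  have hp : p ≠ 0 := by
    rintro rfl
    norm_num at h
  rcases le_total 1 δ with h1 | h1
  · refine le_max_of_le_left ?_
    have hs : ∑ k ∈ Finset.range p, δ⁻¹ ^ (k + 1) ≤ p * δ⁻¹ := by
      simpa using Finset.sum_le_card_nsmul (Finset.range p) (fun k => δ⁻¹ ^ (k + 1)) δ⁻¹
        fun k _ => pow_le_of_le_one (by positivity) (inv_le_one_of_one_le₀ h1) k.succ_ne_zero
    have h2 : 1 ≤ p * c * δ⁻¹ := by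
      calc 1 ≤ _ := h
        _ ≤ c * (p * δ⁻¹) := by gcongr
        _ = _ := by ring
    rwa [← div_eq_mul_inv, one_le_div hδ] at h2
  · refine le_max_of_le_right ?_
    have hs : ∑ k ∈ Finset.range p, δ⁻¹ ^ (k + 1) ≤ p * δ⁻¹ ^ p := by
      simpa using Finset.sum_le_card_nsmul (Finset.range p) (fun k => δ⁻¹ ^ (k + 1)) (δ⁻¹ ^ p)
        fun k hk => pow_le_pow_right₀ ((one_le_inv₀ hδ).2 h1) (Finset.mem_range.1 hk)
    have h2 : 1 ≤ p * c * (δ ^ p)⁻¹ := by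
      calc 1 ≤ _ := h
        _ ≤ c * (p * δ⁻¹ ^ p) := by gcongr
        _ = _ := by rw [inv_pow]; ring
    rw [← div_eq_mul_inv, one_le_div (by positivity)] at h2
    calc δ = (δ ^ p) ^ (1 / (p : ℝ)) := by
          rw [one_div, Real.pow_rpow_inv_natCast hδ.le hp]
      _ ≤ _ := by gcongr

theorem mainTheorem7 (n m : ℕ) (hm : 1 ≤ m) (P : MatPoly n m)
    (hP : (P (Fin.last m)).det ≠ 0)
    (ε : ℝ) (hε : 0 < ε) (w : Fin (m + 1) → ℝ) (hw : ∀ j, 0 ≤ w j) (hw0 : 0 < w 0)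
    (Q : MatPoly n m) (hQ : Q ∈ P.perturbations ε w) (T : P.JordanTriple)
    (μ : ℂ) (hμ : μ ∈ Q.spectrum \ P.spectrum) :
    ∃ d : ℝ, IsLeast ((fun z : ℂ => ‖μ - z‖) '' P.spectrum) d ∧
      d ≤ max (T.theta ε w μ) (T.theta ε w μ ^ (1 / (T.maxLen : ℝ))) := by
  obtain ⟨hμQ, hμP⟩ := hμ
  have hne : P.spectrum.Nonempty := by
    by_contra hemp
    -- Without eigenvalues there are no Jordan blocks, and the sum of `maxLen = 0` terms is empty.
    have hi (i : Fin T.r) : False := hemp ⟨_, T.eig_mem_spectrum i⟩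
    have hp : T.maxLen = 0 :=
      Nat.le_zero.1 (Finset.sup_le fun i _ => (hi i).elim)
    have h1 := T.one_le_condNumber_mul hm hP hQ hμQ one_pos fun i => (hi i).elim
    rw [hp] at h1
    norm_num at h1
  obtain ⟨z, hz, hmin⟩ := P.spectrum.exists_min_image (fun z => ‖μ - z‖) (P.spectrum_finite hμP) hne
  refine ⟨‖μ - z‖, ⟨⟨z, hz, rfl⟩, by rintro _ ⟨y, hy, rfl⟩; exact hmin y hy⟩, ?_⟩
  have hd : 0 < ‖μ - z‖ := norm_pos_iff.2 (sub_ne_zero.2 (by rintro rfl; exact hμP hz))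
  have hwe : 0 ≤ MatPoly.weightEval w ‖μ‖ :=
    Finset.sum_nonneg fun j _ => mul_nonneg (hw j) (by positivity)
  have hc : 0 ≤ T.condNumber * (ε * MatPoly.weightEval w ‖μ‖) :=
    mul_nonneg (mul_nonneg (norm_nonneg _) (norm_nonneg _)) (mul_nonneg hε.le hwe)
  have key := le_max_rpow_of_one_le_mul_sum hc hd
    (T.one_le_condNumber_mul hm hP hQ hμQ hd fun i => hmin _ (T.eig_mem_spectrum i))
  have hθ : T.theta ε w μ = T.maxLen * (T.condNumber * (ε * MatPoly.weightEval w ‖μ‖)) := by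
    rw [MatPoly.JordanTriple.theta]
    ring
  rwa [hθ]
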